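/- Let $(a_{ij})_{i,j=1}^{l}$ be a symmetrizable generalized Cartan matrix: $a_{ii}=2$; $a_{ij}$ is a nonpositive integer for $i\ne j$; $a_{ij}=0$ implies $a_{ji}=0$; and there are coprime positive integers $d_1,\dots,d_l$ such that $b_{ij}=d_ia_{ij}$ is symmetric. Let $q\in\mathbb C$ with $0<|q|<1$ and put $q_i=q^{d_i}$. Formal power series (f.p.s.) have complex coefficients and are infinite in both directions in each variable. The product of finitely many f.p.s. is said to exist (to be well defined) if, for every exponent $p$, the series of all products of coefficients whose exponents add up to $p$ converges to a sum independent of the order of its terms; these sums are then the coefficients of the product. The symbol $\frac1{1-x}$ denotes the series $\sum_{n\ge0}x^n$. Let $F_{km}(z)$, $k,m=1,\dots,l$, be f.p.s. satisfying $$(z-q^{b_{km}})\,F_{mk}(z^{-1})=(q^{b_{km}}z-1)\,F_{km}(z)\qquad\text{whenever } a_{km}\neq0 .$$ Fix $i\ne j$ with $a_{ij}\ne0$ and put $n=1-a_{ij}$, $$P_{ij}(z_1,\dots,z_n,w)=\sum_{\pi\in\Sigma_n}\sum_{k=0}^{n}(-1)^k\begin{bmatrix}n\\k\end{bmatrix}_{q_i}\prod_{p<p'}F_{ii}\Big(\frac{z_{\pi(p')}}{z_{\pi(p)}}\Big)\prod_{r=1}^kF_{ji}\Big(\frac{w}{z_{\pi(r)}}\Big)\prod_{s=k+1}^{n}F_{ij}\Big(\frac{z_{\pi(s)}}{w}\Big),$$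 where $\begin{bmatrix}n\\k\end{bmatrix}_t=\frac{[n]_t!}{[k]_t!\,[n-k]_t!}$, $[m]_t!=[m]_t\cdots[1]_t$, $[m]_t=\frac{t^m-t^{-m}}{t-t^{-1}}$, and $$s_{ij}=\prod_{p\ne p'}\frac1{1-q^{b_{ii}}\frac{z_{p'}}{z_p}},\qquad r'_{ij}=\prod_{s=1}^{n}\frac{w/z_s}{1-q^{b_{ij}}\frac{w}{z_s}} .$$ Suppose that the product of f.p.s. $$s_{ij}\cdot r'_{ij}\cdot\prod_{p\neq p'}\Big(1-q^{b_{ii}}\frac{z_{p'}}{z_p}\Big)\cdot\prod_{s=1}^{n}\Big(\frac{z_s}{w}-q^{b_{ij}}\Big)\cdot P_{ij}$$ is well defined, that is, all the products of the series $F$ occurring in $P_{ij}$ exist, and the product of the five f.p.s. $s_{ij}$, $r'_{ij}$, $\prod_{p\neq p'}(1-q^{b_{ii}}z_{p'}/z_p)$, $\prod_{s}(z_s/w-q^{b_{ij}})$, $P_{ij}$ exists. Then $P_{ij}=0$ as a formal power series. -/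

import Mathlib

open scoped BigOperators

noncomputable section

namespace QuantumSerre

/-- A generalized Cartan matrix `a`, symmetrized by coprime positive integers `d`:
the matrix `d i * a i j` is symmetric. -/
structure IsSymmetrizedGCM {l : ℕ} (a : Matrix (Fin l) (Fin l) ℤ) (d : Fin l → ℕ) : Prop where
  diag : ∀ i, a i i = 2
  nonpos : ∀ i j, i ≠ j → a i j ≤ 0
  zero_symm : ∀ i j, a i j = 0 → a j i = 0
  pos : ∀ i, 0 < d i
  coprime : Finset.univ.gcd d = 1
  symm : ∀ i j, (d i : ℤ) * a i j = (d j : ℤ) * a j i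

/-- Formal power series, infinite in all directions, with complex coefficients and with exponents in
the lattice `G`: the series `f` is `∑ g, f g • X ^ g`. For `G = ℤ` these are the series in one
variable, infinite in both directions. -/
abbrev Series (G : Type*) := G → ℂ

section Products

variable {G : Type*} [AddCommGroup G] {ι : Type*} [Fintype ι]

/-- The product of a finite family of formal power series exists: for every exponent `p` the series
of all products of coefficients with exponents adding up to `p` converges, independently of the
ordering of its terms. -/
def ProdExists (f : ι → Series G) : Prop :=
  ∀ p : G, Summable fun m : {m : ι → G // ∑ i, m i = p} => ∏ i, f i (m.1 i)

/-- The product of a finite family of formal power series (meaningful when it exists). -/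
def prodSeries (f : ι → Series G) : Series G :=
  fun p => ∑' m : {m : ι → G // ∑ i, m i = p}, ∏ i, f i (m.1 i)

end Products

section Substitution

variable {G : Type*} [AddCommGroup G]

open Classical in
/-- The monomial with exponent `μ` and coefficient `1`. -/
def monomial (μ : G) : Series G := Pi.single μ 1

/-- `F(x)` for a series `F` in one variable and the monomial `x` with exponent `μ`, where `μ` is not
a torsion element: the coefficient at `n • μ` is `F n`, all other coefficients are `0`. -/
def subst (F : Series ℤ) (μ : G) : Series G :=
  Function.extend (fun n : ℤ => n • μ) F 0

/-- The geometric series `1 / (1 - c z) = ∑_{n ≥ 0} c ^ n z ^ n`. -/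
def geom (c : ℂ) : Series ℤ := fun n => if 0 ≤ n then c ^ n else 0

/-- The series `z / (1 - c z) = ∑_{n ≥ 0} c ^ n z ^ (n + 1)`. -/
def geomShift (c : ℂ) : Series ℤ := fun n => if 1 ≤ n then c ^ (n - 1) else 0

end Substitution

/-- The system of functional equations
`(z - q ^ b i j) F j i (z⁻¹) = (q ^ b i j z - 1) F i j (z)` whenever `a i j ≠ 0`,
where `b i j = d i * a i j`. -/
def IsSolution {l : ℕ} (a : Matrix (Fin l) (Fin l) ℤ) (d : Fin l → ℕ) (q : ℂ)
    (F : Fin l → Fin l → Series ℤ) : Prop :=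
  ∀ i j, a i j ≠ 0 →
    prodSeries ![monomial (1 : ℤ) - q ^ ((d i : ℤ) * a i j) • monomial (0 : ℤ),
        subst (F j i) (-1 : ℤ)] =
      prodSeries ![q ^ ((d i : ℤ) * a i j) • monomial (1 : ℤ) - monomial (0 : ℤ), F i j]

/-- `[n]_t = (t ^ n - t ^ (-n)) / (t - t⁻¹)`. -/
def qInt (t : ℂ) (n : ℕ) : ℂ := (t ^ (n : ℤ) - t ^ (-(n : ℤ))) / (t - t⁻¹)

/-- `[n]_t! = [n]_t ⋯ [1]_t`. -/
def qFactorial (t : ℂ) (n : ℕ) : ℂ := ∏ k ∈ Finset.range n, qInt t (k + 1)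

/-- The symmetric `q`-binomial coefficient `[m]_t! / ([k]_t! [m - k]_t!)`, for `k ≤ m`. -/
def qBinom (t : ℂ) (m k : ℕ) : ℂ := qFactorial t m / (qFactorial t k * qFactorial t (m - k))

/-- Exponents of the variables `z_1, …, z_n` (indices `some s`) and `w` (index `none`). -/
abbrev Exps (n : ℕ) := Option (Fin n) → ℤ

/-- The exponent of the monomial `z_s`. -/
def zExp {n : ℕ} (s : Fin n) : Exps n := Pi.single (some s) 1

/-- The exponent of the monomial `w`. -/
def wExp {n : ℕ} : Exps n := Pi.single none 1

/-- The family of all the factors of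
`∏_{p < q} Fii (z_{π q} / z_{π p}) ∏_{r ≤ k} Fji (w / z_{π r}) ∏_{s > k} Fij (z_{π s} / w)`.
The positions `1, …, n` are numbered `0, …, n - 1` here. -/
def termFactors {n : ℕ} (Fii Fij Fji : Series ℤ) (π : Equiv.Perm (Fin n)) (k : ℕ) :
    {x : Fin n × Fin n // x.1 < x.2} ⊕ Fin n → Series (Exps n) :=
  Sum.elim
    (fun x => subst Fii (zExp (π x.1.2) - zExp (π x.1.1)))
    (fun s => if (s : ℕ) < k then subst Fji (wExp - zExp (π s))
      else subst Fij (zExp (π s) - wExp))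

/-- The series
`P = ∑_π ∑_{k ≤ n} (-1) ^ k [n choose k]_t ∏_{p < q} Fii (z_{π q} / z_{π p}) ∏_{r ≤ k} Fji (w / z_{π r})
∏_{s > k} Fij (z_{π s} / w)`. -/
def serreSeries (n : ℕ) (t : ℂ) (Fii Fij Fji : Series ℤ) : Series (Exps n) :=
  ∑ π : Equiv.Perm (Fin n), ∑ k ∈ Finset.range (n + 1),
    ((-1) ^ k * qBinom t n k) • prodSeries (termFactors Fii Fij Fji π k)

/-- `s = ∏_{p ≠ q} 1 / (1 - c z_q / z_p)`. -/
def sSeries (n : ℕ) (c : ℂ) : Series (Exps n) :=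
  prodSeries fun x : {x : Fin n × Fin n // x.1 ≠ x.2} =>
    subst (geom c) (zExp x.1.2 - zExp x.1.1)

/-- `r' = ∏_s (w / z_s) / (1 - c w / z_s)`. -/
def rSeries' (n : ℕ) (c : ℂ) : Series (Exps n) :=
  prodSeries fun s : Fin n => subst (geomShift c) (wExp - zExp s)

/-- `∏_{p ≠ q} (1 - c z_q / z_p)`. -/
def sDenom (n : ℕ) (c : ℂ) : Series (Exps n) :=
  prodSeries fun x : {x : Fin n × Fin n // x.1 ≠ x.2} =>
    monomial 0 - c • monomial (zExp x.1.2 - zExp x.1.1)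

/-- `∏_s (z_s / w - c)`. -/
def rDenom' (n : ℕ) (c : ℂ) : Series (Exps n) :=
  prodSeries fun s : Fin n => monomial (zExp s - wExp) - c • monomial 0

/-- The product `s · r' · ∏_{p ≠ q} (1 - cii z_q / z_p) · ∏_s (z_s / w - cij) · P` is well defined:
all products that occur in `P` exist, so that `P` is a formal power series, and the product of the
five series exists. -/
def ConstraintWellDefined (n : ℕ) (t cii cij : ℂ) (Fii Fij Fji : Series ℤ) : Prop :=
  (∀ (π : Equiv.Perm (Fin n)), ∀ k ≤ n, ProdExists (termFactors Fii Fij Fji π k)) ∧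
    ProdExists ![sSeries n cii, rSeries' n cij, sDenom n cii, rDenom' n cij,
      serreSeries n t Fii Fij Fji]

end QuantumSerre

end

/-! Formal series form a module over Laurent polynomials (`act`). Multiply $P_{ij}$ by
$L=\prod_{p\ne p'}(1-q^{b_{ii}}z_{p'}/z_p)$ and $M=\prod_s(z_s/w-q^{b_{ij}})$. The functional
equations then turn every factor $F_{ii}(z_b/z_a)$ with $a>b$ into $F_{ii}(z_a/z_b)$, and every
$F_{ji}(w/z_s)$ into $F_{ij}(z_s/w)$, at the cost of a Laurent polynomial. Each term becomes a
polynomial multiple of one and the same series, the term with $\pi=1$, $k=0$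
(`act_denom_prodSeries_termFactors`); the inversions of $\pi$ contribute its sign.

The sum of the multipliers is, up to a common factor, the antisymmetrized polynomial `serreSum`. It
vanishes identically (`serreSum_eq_zero`): as a polynomial in one $z$ it has more roots than its
degree allows, by a $q$-binomial identity. Hence $LMP_{ij}=0$.

This alone does not give $P_{ij}=0$, since products of two-sided series are not associative in
general. But $s_{ij}$ and $r'_{ij}$ are inverse to $L$ and $M$, and summability of the fivefold
product permits both bracketings: $s r'(LMP)=0$ and $(sL)(r'M)P=P$ (`eq_zero_of_prodExists`). -/

open scoped BigOperators

noncomputable section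

namespace QuantumSerre

/-! ### The polynomial identity, reduced to two identities for the coefficients. -/

section SerreSum

variable {R : Type*} [CommRing R]

/-- The summand of `serreSum` attached to an ordering `x` of the variables, without its sign. -/
def serreSummand {n : ℕ} (T c : R) (coef : ℕ → R) (w : R) (x : Fin n → R) : R :=
  (∏ p, ∏ p', if p < p' then x p' - T * x p else 1) *
    ∑ k ∈ Finset.range (n + 1),
      coef k * ∏ s : Fin n, if (s : ℕ) < k then c * x s - w else x s - c * w

/-- The antisymmetrization of `serreSummand` in the variables `z`. -/
def serreSum {n : ℕ} (T c : R) (coef : ℕ → R) (w : R) (z : Fin n → R) : R :=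
  ∑ π : Equiv.Perm (Fin n), ((Equiv.Perm.sign π : ℤ) : R) *
    serreSummand T c coef w (fun s => z (π s))

theorem map_serreSum {S : Type*} [CommRing S] (f : R →+* S) {n : ℕ} (T c : R) (coef : ℕ → R)
    (w : R) (z : Fin n → R) :
    f (serreSum T c coef w z) =
      serreSum (f T) (f c) (fun k => f (coef k)) (f w) (fun s => f (z s)) := by
  simp only [serreSum, serreSummand, map_sum, map_mul, map_prod, apply_ite f, map_sub, map_one,
    map_intCast]

/-- Composing every ordering with the transposition of `a` and `b` flips all signs but changes no
summand. -/
theorem serreSum_eq_zero_of_eq [IsDomain R] [CharZero R] {n : ℕ} (T c : R) (coef : ℕ → R)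
    (w : R) (z : Fin n → R) {a b : Fin n} (hab : a ≠ b) (hz : z a = z b) :
    serreSum T c coef w z = 0 := by
  have key : serreSum T c coef w z = -serreSum T c coef w z := by
    conv_lhs => rw [serreSum, ← Equiv.sum_comp (Equiv.mulLeft (Equiv.swap a b))]
    rw [serreSum, ← Finset.sum_neg_distrib]
    refine Finset.sum_congr rfl fun π _ => ?_
    have hz' : ∀ s, z (Equiv.swap a b s) = z s := by
      intro s
      by_cases h1 : s = a
      · subst h1; simp [hz]
      by_cases h2 : s = b
      · subst h2; simp [hz]
      rw [Equiv.swap_apply_of_ne_of_ne h1 h2]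
    simp [Equiv.Perm.sign_mul, Equiv.Perm.sign_swap hab, hz']
  have h2 : (2 : R) * serreSum T c coef w z = 0 := by linear_combination key
  exact (mul_eq_zero.mp h2).resolve_left two_ne_zero

/-- The permutation that puts `0` at position `m` and orders the other elements by `σ`. -/
def insertZeroPerm {n : ℕ} (x : Fin (n + 1) × Equiv.Perm (Fin n)) : Equiv.Perm (Fin (n + 1)) :=
  Equiv.Perm.decomposeFin.symm (0, x.2) * Fin.cycleRange x.1

theorem insertZeroPerm_self {n : ℕ} (m : Fin (n + 1)) (σ : Equiv.Perm (Fin n)) :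
    insertZeroPerm (m, σ) m = 0 := by
  simp [insertZeroPerm]

theorem insertZeroPerm_succAbove {n : ℕ} (m : Fin (n + 1)) (σ : Equiv.Perm (Fin n)) (i : Fin n) :
    insertZeroPerm (m, σ) (m.succAbove i) = (σ i).succ := by
  simp [insertZeroPerm]

theorem sign_insertZeroPerm {n : ℕ} (m : Fin (n + 1)) (σ : Equiv.Perm (Fin n)) :
    Equiv.Perm.sign (insertZeroPerm (m, σ)) = (-1) ^ (m : ℕ) * Equiv.Perm.sign σ := by
  simp [insertZeroPerm, Fin.sign_cycleRange, mul_comm]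

theorem insertZeroPerm_bijective (n : ℕ) :
    Function.Bijective (insertZeroPerm : Fin (n + 1) × Equiv.Perm (Fin n) → _) := by
  rw [Fintype.bijective_iff_injective_and_card]
  refine ⟨?_, by simp [Fintype.card_perm, Nat.factorial_succ]⟩
  rintro ⟨m, σ⟩ ⟨m', σ'⟩ h
  have hm : m = m' := by
    apply (insertZeroPerm (m, σ)).injective
    rw [insertZeroPerm_self, h, insertZeroPerm_self]
  subst hm
  congr 1
  ext i : 1
  have := congrArg (fun e : Equiv.Perm (Fin (n + 1)) => e (m.succAbove i)) h
  simpa only [insertZeroPerm_succAbove, Fin.succ_inj] using this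

/-- Isolates the dependence on one variable `Z`, placed at position `m`. Here `k` counts only the
`y` in the initial block. If `Z` lies outside the block, then `k ≤ m` and the block has size `k`; if
inside, then `m ≤ k` and the block has size `k + 1`, whence `coef (k + 1)`. -/
theorem serreSummand_insert {n : ℕ} (T c : R) (coef : ℕ → R) (w : R) (x : Fin (n + 1) → R)
    (m : Fin (n + 1)) (y : Fin n → R) (Z : R) (hx : x m = Z)
    (hxy : ∀ i, x (m.succAbove i) = y i) :
    serreSummand T c coef w x =
      (∏ p, ∏ p', if p < p' then y p' - T * y p else 1) *
      ∑ k ∈ Finset.range (n + 1), (∏ s : Fin n, if (s : ℕ) < k then c * y s - w else y s - c * w) *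
        ((∏ i : Fin n, if (i : ℕ) < m then Z - T * y i else y i - T * Z) *
          ((if k ≤ m then coef k * (Z - c * w) else 0) +
            if (m : ℕ) ≤ k then coef (k + 1) * (c * Z - w) else 0)) := by
  have hlt : ∀ i : Fin n, m.succAbove i < m ↔ (i : ℕ) < m := by
    intro i
    rw [Fin.succAbove_lt_iff_castSucc_lt, Fin.lt_def]; simp
  have hgt : ∀ i : Fin n, m < m.succAbove i ↔ ¬ (i : ℕ) < m := by
    intro i
    rw [← hlt, not_lt]
    exact ⟨le_of_lt, fun h => lt_of_le_of_ne h (Fin.ne_succAbove m i)⟩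
  have hval : ∀ i : Fin n, ((m.succAbove i : Fin (n + 1)) : ℕ) =
      if (i : ℕ) < m then (i : ℕ) else (i : ℕ) + 1 := by
    intro i
    simp only [Fin.succAbove, Fin.lt_def, Fin.val_castSucc]
    split_ifs <;> simp
  have hpairs : (∏ p, ∏ p', if p < p' then x p' - T * x p else 1) =
      (∏ p, ∏ p', if p < p' then y p' - T * y p else 1) *
        ∏ i : Fin n, if (i : ℕ) < m then Z - T * y i else y i - T * Z := by
    rw [Fin.prod_univ_succAbove _ m, Fin.prod_univ_succAbove _ m]
    simp only [Fin.prod_univ_succAbove _ m, lt_irrefl, if_false, one_mul, hx, hxy, hlt, hgt,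
      Fin.succAbove_lt_succAbove_iff, Finset.prod_mul_distrib]
    rw [← mul_assoc, mul_comm, ← Finset.prod_mul_distrib]
    congr 1
    refine Finset.prod_congr rfl fun i _ => ?_
    split_ifs <;> simp
  have hW : ∀ k : ℕ, (∏ s : Fin (n + 1), if (s : ℕ) < k then c * x s - w else x s - c * w) =
      (if (m : ℕ) < k then c * Z - w else Z - c * w) *
        ∏ s : Fin n, if (s : ℕ) < (if (m : ℕ) < k then k - 1 else k) then c * y s - w
          else y s - c * w := by
    intro k
    rw [Fin.prod_univ_succAbove _ m, hx]
    congr 1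
    refine Finset.prod_congr rfl fun i _ => ?_
    rw [hxy, hval]
    refine if_congr ?_ rfl rfl
    split_ifs <;> omega
  have hm : (m : ℕ) ≤ n := Nat.lt_succ_iff.mp m.2
  rw [serreSummand, hpairs, mul_assoc]
  congr 1
  rw [Finset.mul_sum]
  simp only [hW]
  set W : ℕ → R := fun k => ∏ s : Fin n, if (s : ℕ) < k then c * y s - w else y s - c * w
  set B := ∏ i : Fin n, if (i : ℕ) < m then Z - T * y i else y i - T * Z
  have h1 : ∀ k, B * (coef k * ((if (m : ℕ) < k then c * Z - w else Z - c * w) *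
      W (if (m : ℕ) < k then k - 1 else k))) =
      (if k ≤ m then W k * (B * (coef k * (Z - c * w))) else 0) +
      (if (m : ℕ) < k then W (k - 1) * (B * (coef k * (c * Z - w))) else 0) := by
    intro k
    by_cases h : (m : ℕ) < k
    · simp only [h, if_true, Nat.not_le.mpr h, if_false]; ring
    · simp only [h, if_false, Nat.le_of_not_lt h, if_true]; ring
  rw [Finset.sum_congr rfl fun k _ => h1 k]
  simp only [mul_add, Finset.sum_add_distrib]
  congr 1
  -- A block of all `n + 1` variables cannot omit `Z`, and below an empty block cannot contain it,
  -- so each sum loses one extreme term.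
  · rw [Finset.sum_range_succ, if_neg (by omega), add_zero]
    simp only [mul_ite, mul_zero]
    rfl
  · rw [Finset.sum_range_succ', if_neg (by omega), add_zero]
    simp only [Nat.lt_succ_iff, Nat.add_sub_cancel, mul_ite, mul_zero]
    rfl

theorem serreSum_cons {n : ℕ} (T c : R) (coef : ℕ → R) (w : R) (Z : R) (y : Fin n → R) :
    serreSum T c coef w (Fin.cons Z y : Fin (n + 1) → R) =
      ∑ σ : Equiv.Perm (Fin n), ((Equiv.Perm.sign σ : ℤ) : R) *
      ((∏ p, ∏ p', if p < p' then y (σ p') - T * y (σ p) else 1) *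
      ∑ k ∈ Finset.range (n + 1),
        (∏ s : Fin n, if (s : ℕ) < k then c * y (σ s) - w else y (σ s) - c * w) *
        ∑ m : Fin (n + 1), (-1) ^ (m : ℕ) *
          ((∏ i : Fin n, if (i : ℕ) < m then Z - T * y (σ i) else y (σ i) - T * Z) *
          ((if k ≤ m then coef k * (Z - c * w) else 0) +
            if (m : ℕ) ≤ k then coef (k + 1) * (c * Z - w) else 0))) := by
  rw [serreSum, ← (Equiv.ofBijective _ (insertZeroPerm_bijective n)).sum_comp,
    Fintype.sum_prod_type, Finset.sum_comm]
  refine Finset.sum_congr rfl fun σ _ => ?_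
  simp only [Equiv.ofBijective_apply, Finset.mul_sum]
  rw [Finset.sum_comm]
  refine Finset.sum_congr rfl fun m _ => ?_
  rw [serreSummand_insert T c coef w _ m (fun i => y (σ i)) Z
    (by rw [insertZeroPerm_self, Fin.cons_zero])
    (fun i => by rw [insertZeroPerm_succAbove, Fin.cons_succ]), sign_insertZeroPerm]
  simp only [Finset.mul_sum]
  refine Finset.sum_congr rfl fun k _ => ?_
  push_cast
  ring

theorem prod_ite_lt_const {n : ℕ} (m : Fin (n + 1)) (u v : R) :
    (∏ i : Fin n, if (i : ℕ) < m then u else v) = u ^ (m : ℕ) * v ^ (n - m) := by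
  have hm : (m : ℕ) ≤ n := Nat.lt_succ_iff.mp m.2
  rw [Fin.prod_univ_eq_prod_range (fun i => if i < (m : ℕ) then u else v) n]
  generalize (m : ℕ) = j at hm
  obtain ⟨d, rfl⟩ := Nat.exists_eq_add_of_le hm
  rw [Finset.prod_range_add]
  congr 1
  · rw [Finset.prod_congr rfl (g := fun _ => u) fun i hi => if_pos (Finset.mem_range.mp hi)]; simp
  · simp

-- All `n + 1` factors are at most linear in `X`, so only the coefficient of `X ^ (n + 1)` matters.
-- The signs combine as `(-1) ^ m * (-T) ^ (n - m) = (-1) ^ n * T ^ (n - m)`, and the rest is `h`.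
open Polynomial in
theorem degree_serreSum_inner_lt {n : ℕ} (T c : R) (coef : ℕ → R) (w : R) (y : Fin n → R) (k : ℕ)
    (h : ∑ m : Fin (n + 1), T ^ (n - m : ℕ) * ((if k ≤ m then coef k else 0) +
      if (m : ℕ) ≤ k then coef (k + 1) * c else 0) = 0) :
    (∑ m : Fin (n + 1), (-1) ^ (m : ℕ) *
      ((∏ i : Fin n, if (i : ℕ) < m then X - C T * C (y i) else C (y i) - C T * X) *
      ((if k ≤ m then C (coef k) * (X - C c * C w) else 0) +
        if (m : ℕ) ≤ k then C (coef (k + 1)) * (C c * X - C w) else 0))).degree <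
      ((n + 1 : ℕ) : WithBot ℕ) := by
  have hlin : ∀ m : Fin (n + 1), ((if k ≤ m then C (coef k) * (X - C c * C w) else 0) +
        if (m : ℕ) ≤ k then C (coef (k + 1)) * (C c * X - C w) else 0 : R[X]).natDegree ≤ 1 := by
    intro m
    split_ifs <;> compute_degree!
  have hB1 : ∀ (m : Fin (n + 1)) (i : Fin n),
      (if (i : ℕ) < m then X - C T * C (y i) else C (y i) - C T * X : R[X]).natDegree ≤ 1 := by
    intro m i
    split_ifs <;> compute_degree!
  have hB : ∀ m : Fin (n + 1), (∏ i : Fin n,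
      if (i : ℕ) < m then X - C T * C (y i) else C (y i) - C T * X : R[X]).natDegree ≤ n := by
    intro m
    refine (natDegree_prod_le _ _).trans ((Finset.sum_le_sum fun i _ => hB1 m i).trans ?_)
    simp
  have hBc : ∀ m : Fin (n + 1), (∏ i : Fin n,
      if (i : ℕ) < m then X - C T * C (y i) else C (y i) - C T * X : R[X]).coeff n =
      (-T) ^ (n - m : ℕ) := by
    intro m
    have h1 := coeff_prod_of_natDegree_le (s := Finset.univ) _ 1 (fun i _ => hB1 m i)
    rw [Finset.card_univ, Fintype.card_fin, mul_one] at h1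
    rw [h1, Finset.prod_congr rfl (g := fun i : Fin n => if (i : ℕ) < m then 1 else -T),
      prod_ite_lt_const, one_pow, one_mul]
    intro i _
    split_ifs <;> simp [coeff_C]
  rw [degree_lt_iff_coeff_zero]
  intro N hN
  have hsign : ∀ m : ℕ, ((-1) ^ m : R[X]) = C ((-1) ^ m) := by intro m; simp
  simp only [finsetSum_coeff, hsign, coeff_C_mul]
  rcases hN.eq_or_lt with rfl | hN
  · refine Eq.trans ?_ (congrArg (fun x => (-1) ^ n * x) h |>.trans (mul_zero _))
    rw [Finset.mul_sum]
    refine Finset.sum_congr rfl fun m _ => ?_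
    rw [coeff_mul_add_eq_of_natDegree_le (hB m) (hlin m), hBc, neg_pow T, ← mul_assoc, ← mul_assoc,
      ← pow_add, Nat.add_sub_cancel' (Nat.lt_succ_iff.mp m.2), mul_assoc]
    congr 2
    split_ifs <;> simp [coeff_C]
  · refine Finset.sum_eq_zero fun m _ => ?_
    rw [coeff_eq_zero_of_natDegree_lt, mul_zero]
    exact (natDegree_mul_le.trans (add_le_add (hB m) (hlin m))).trans_lt hN

-- Regard the sum as a polynomial in `z 0`. By `h1` its degree is at most `n`; it vanishes at the
-- `n` other variables by antisymmetry and at `0` by `h0`. These are `n + 1` distinct roots.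
open Polynomial in
theorem serreSum_eq_zero_of_injective [IsDomain R] [CharZero R] {n : ℕ} (T c : R) (coef : ℕ → R)
    (w : R) (z : Fin (n + 1) → R) (hz : Function.Injective z) (hz0 : ∀ s, z s ≠ 0)
    (h0 : ∀ k ≤ n, ∑ m : Fin (n + 1), T ^ (m : ℕ) * ((if k ≤ m then coef k * c else 0) +
      if (m : ℕ) ≤ k then coef (k + 1) else 0) = 0)
    (h1 : ∀ k ≤ n, ∑ m : Fin (n + 1), T ^ (n - m : ℕ) * ((if k ≤ m then coef k else 0) +
      if (m : ℕ) ≤ k then coef (k + 1) * c else 0) = 0) :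
    serreSum T c coef w z = 0 := by
  set y : Fin n → R := fun i => z i.succ with hy
  set p : R[X] := serreSum (C T) (C c) (fun k => C (coef k)) (C w)
    (Fin.cons X (fun i => C (y i)) : Fin (n + 1) → R[X]) with hp
  have heval : ∀ a, p.eval a = serreSum T c coef w (Fin.cons a y : Fin (n + 1) → R) := by
    intro a
    rw [hp, ← coe_evalRingHom, map_serreSum]
    simp only [coe_evalRingHom, eval_C]
    congr 1
    ext s
    refine Fin.cases ?_ (fun i => ?_) s <;> simp
  have hdeg : p.degree < ((n + 1 : ℕ) : WithBot ℕ) := by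
    rw [hp, serreSum_cons, ← mem_degreeLT]
    refine Submodule.sum_mem _ fun σ _ => ?_
    have hA : (∏ p, ∏ p', if p < p' then C (y (σ p')) - C T * C (y (σ p)) else 1 : R[X]) =
        C (∏ p, ∏ p', if p < p' then y (σ p') - T * y (σ p) else 1) := by
      simp only [map_prod, apply_ite C, map_sub, map_mul, map_one]
    have hW : ∀ k : ℕ, (∏ s : Fin n, if (s : ℕ) < k then C c * C (y (σ s)) - C w
        else C (y (σ s)) - C c * C w : R[X]) =
        C (∏ s : Fin n, if (s : ℕ) < k then c * y (σ s) - w else y (σ s) - c * w) := by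
      intro k
      simp only [map_prod, apply_ite C, map_sub, map_mul]
    rw [hA, ← C_eq_intCast, ← smul_eq_C_mul, ← smul_eq_C_mul]
    refine Submodule.smul_mem _ _ (Submodule.smul_mem _ _ (Submodule.sum_mem _ fun k hk => ?_))
    rw [hW, ← smul_eq_C_mul]
    refine Submodule.smul_mem _ _ (mem_degreeLT.mpr ?_)
    exact degree_serreSum_inner_lt T c coef w (fun i => y (σ i)) k
      (h1 k (Nat.lt_succ_iff.mp (Finset.mem_range.mp hk)))
  have hp0 : p = 0 := by
    refine eq_zero_of_degree_lt_of_eval_index_eq_zero (s := Finset.univ)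
      (v := (Fin.cons 0 y : Fin (n + 1) → R)) ?_ (by simpa using hdeg) ?_
    · refine Function.Injective.injOn (Fin.cons_injective_iff.mpr ⟨?_, ?_⟩)
      · rintro ⟨i, hi⟩
        exact hz0 _ hi
      · exact hz.comp (Fin.succ_injective n)
    · intro s _
      rw [heval]
      refine Fin.cases ?_ (fun i => ?_) s
      · rw [Fin.cons_zero, serreSum_cons]
        refine Finset.sum_eq_zero fun σ _ => ?_
        rw [Finset.sum_eq_zero, mul_zero, mul_zero]
        intro k hk
        refine mul_eq_zero_of_right _ ?_
        refine Eq.trans ?_ ((congrArg (fun x => (-w * ∏ i, y (σ i)) * x)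
          (h0 k (Nat.lt_succ_iff.mp (Finset.mem_range.mp hk)))).trans (mul_zero _))
        rw [Finset.mul_sum]
        refine Finset.sum_congr rfl fun m _ => ?_
        -- At `Z = 0` the position `m` enters only through `(-T) ^ m`, whose sign cancels `(-1) ^
        -- m`.
        have hB : (∏ i : Fin n, if (i : ℕ) < m then 0 - T * y (σ i) else y (σ i) - T * 0) =
            (-T) ^ (m : ℕ) * ∏ i, y (σ i) := by
          have h2 := prod_ite_lt_const m (-T) 1
          rw [one_pow, mul_one] at h2
          rw [← h2, ← Finset.prod_mul_distrib]
          refine Finset.prod_congr rfl fun i _ => ?_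
          split_ifs <;> ring
        rw [hB, neg_pow T, ← mul_assoc, ← mul_assoc, ← mul_assoc, ← mul_pow]
        split_ifs <;> simp <;> ring
      · exact serreSum_eq_zero_of_eq T c coef w _ (a := 0) (b := i.succ) (Fin.succ_ne_zero i).symm
          (by simp)
  have hcons : z = (Fin.cons (z 0) y : Fin (n + 1) → R) := (Fin.cons_self_tail z).symm
  rw [hcons, ← heval, hp0, eval_zero]

end SerreSum

/-! ### The two coefficient identities for symmetric $q$-binomials. -/

section QBinomial

theorem qFactorial_succ (t : ℂ) (n : ℕ) :
    qFactorial t (n + 1) = qFactorial t n * qInt t (n + 1) := by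
  rw [qFactorial, Finset.prod_range_succ, ← qFactorial]

theorem pow_ne_one_of_norm_lt_one {t : ℂ} (h1 : ‖t‖ < 1) {k : ℕ} (hk : k ≠ 0) : t ^ k ≠ 1 := by
  intro h
  have := congrArg norm h
  rw [norm_pow, norm_one] at this
  exact absurd this (pow_lt_one₀ (norm_nonneg t) h1 hk).ne

/-- The geometric sum of `t ^ 2` in terms of the symmetric `q`-integer. -/
theorem geom_sum_sq {t : ℂ} (h0 : t ≠ 0) (h1 : ‖t‖ < 1) (n : ℕ) :
    ∑ i ∈ Finset.range (n + 1), (t ^ 2) ^ i = t ^ n * qInt t (n + 1) := by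
  have h2 : t ^ 2 ≠ 1 := pow_ne_one_of_norm_lt_one h1 two_ne_zero
  have h3 : t ^ 2 - 1 ≠ 0 := sub_ne_zero.mpr h2
  have h4 : t - t⁻¹ = (t ^ 2 - 1) / t := by field_simp
  rw [geom_sum_eq h2, qInt, zpow_neg, zpow_natCast, h4]
  field_simp
  ring

theorem qInt_ne_zero {t : ℂ} (h0 : t ≠ 0) (h1 : ‖t‖ < 1) (n : ℕ) : qInt t (n + 1) ≠ 0 := by
  have h := geom_sum_sq h0 h1 n
  have h2 : t ^ 2 ≠ 1 := pow_ne_one_of_norm_lt_one h1 two_ne_zero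
  intro h3
  rw [h3, mul_zero, geom_sum_eq h2, div_eq_zero_iff, ← pow_mul] at h
  rcases h with h | h
  · exact pow_ne_one_of_norm_lt_one h1 (by omega) (sub_eq_zero.mp h)
  · exact h2 (sub_eq_zero.mp h)

theorem qFactorial_ne_zero {t : ℂ} (h0 : t ≠ 0) (h1 : ‖t‖ < 1) (n : ℕ) : qFactorial t n ≠ 0 :=
  Finset.prod_ne_zero_iff.mpr fun k _ => qInt_ne_zero h0 h1 k

theorem qBinom_mul_qInt {t : ℂ} (h0 : t ≠ 0) (h1 : ‖t‖ < 1) (k d : ℕ) :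
    qBinom t (k + d + 1) k * qInt t (d + 1) =
      qBinom t (k + d + 1) (k + 1) * qInt t (k + 1) := by
  have e1 : k + d + 1 - k = d + 1 := by omega
  have e2 : k + d + 1 - (k + 1) = d := by omega
  rw [qBinom, qBinom, e1, e2, qFactorial_succ t k, qFactorial_succ t d]
  have := qInt_ne_zero h0 h1 k
  have := qInt_ne_zero h0 h1 d
  have := qFactorial_ne_zero h0 h1 k
  have := qFactorial_ne_zero h0 h1 d
  field_simp

theorem sum_fin_ite_le (k d : ℕ) (f : ℕ → ℂ) :
    ∑ m : Fin (k + d + 1), (if k ≤ (m : ℕ) then f m else 0) =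
      ∑ i ∈ Finset.range (d + 1), f (k + i) := by
  rw [← Finset.sum_range (fun m => if k ≤ m then f m else 0), add_assoc, Finset.sum_range_add,
    Finset.sum_eq_zero, zero_add]
  · simp
  · intro i hi
    rw [if_neg (by simpa using hi)]

theorem sum_fin_ite_ge (k d : ℕ) (f : ℕ → ℂ) :
    ∑ m : Fin (k + d + 1), (if (m : ℕ) ≤ k then f m else 0) =
      ∑ i ∈ Finset.range (k + 1), f i := by
  rw [← Finset.sum_range (fun m => if m ≤ k then f m else 0), add_right_comm,
    Finset.sum_range_add, Finset.sum_eq_zero (s := Finset.range d), add_zero]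
  · refine Finset.sum_congr rfl fun i hi => if_pos (Nat.lt_succ_iff.mp (Finset.mem_range.mp hi))
  · intro i _
    rw [if_neg (by omega)]

/-- The two partial geometric sums are powers of `t` times `qInt t (d + 1)` and `qInt t (k + 1)`;
they cancel by `qBinom_mul_qInt`. -/
theorem sum_pow_mul_qBinom_const {t : ℂ} (h0 : t ≠ 0) (h1 : ‖t‖ < 1) (k d : ℕ) :
    ∑ m : Fin (k + d + 1), (t ^ 2) ^ (m : ℕ) *
      ((if k ≤ m then ((-1) ^ k * qBinom t (k + d + 1) k) * (t ^ (k + d))⁻¹ else 0) +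
      if (m : ℕ) ≤ k then (-1) ^ (k + 1) * qBinom t (k + d + 1) (k + 1) else 0) = 0 := by
  simp only [mul_add, mul_ite, mul_zero, Finset.sum_add_distrib]
  rw [sum_fin_ite_le k d (fun m => (t ^ 2) ^ m * (((-1) ^ k * qBinom t (k + d + 1) k) *
      (t ^ (k + d))⁻¹)),
    sum_fin_ite_ge k d (fun m => (t ^ 2) ^ m * ((-1) ^ (k + 1) * qBinom t (k + d + 1) (k + 1)))]
  simp only [pow_add (t ^ 2) k, mul_assoc]
  rw [← Finset.mul_sum, ← Finset.sum_mul, ← Finset.sum_mul, geom_sum_sq h0 h1, geom_sum_sq h0 h1]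
  have h := qBinom_mul_qInt h0 h1 k d
  have e : (t ^ 2) ^ k * t ^ d * (t ^ (k + d))⁻¹ = t ^ k := by
    rw [pow_add, ← pow_mul]; field_simp; ring
  linear_combination (-1) ^ k * qBinom t (k + d + 1) k * qInt t (d + 1) * e + (-1) ^ k * t ^ k * h

theorem sum_pow_mul_qBinom_top {t : ℂ} (h0 : t ≠ 0) (h1 : ‖t‖ < 1) (k d : ℕ) :
    ∑ m : Fin (k + d + 1), (t ^ 2) ^ (k + d - m : ℕ) *
      ((if k ≤ m then (-1) ^ k * qBinom t (k + d + 1) k else 0) +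
      if (m : ℕ) ≤ k then ((-1) ^ (k + 1) * qBinom t (k + d + 1) (k + 1)) * (t ^ (k + d))⁻¹
        else 0) = 0 := by
  simp only [mul_add, mul_ite, mul_zero, Finset.sum_add_distrib]
  rw [sum_fin_ite_le k d (fun m => (t ^ 2) ^ (k + d - m) * ((-1) ^ k * qBinom t (k + d + 1) k)),
    sum_fin_ite_ge k d (fun m => (t ^ 2) ^ (k + d - m) *
      (((-1) ^ (k + 1) * qBinom t (k + d + 1) (k + 1)) * (t ^ (k + d))⁻¹)),
    ← Finset.sum_mul, ← Finset.sum_mul, ← Finset.sum_range_reflect,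
    ← Finset.sum_range_reflect _ (k + 1),
    Finset.sum_congr rfl (g := fun i => (t ^ 2) ^ i),
    Finset.sum_congr (s₁ := Finset.range (k + 1)) rfl (g := fun i => (t ^ 2) ^ d * (t ^ 2) ^ i),
    ← Finset.mul_sum, geom_sum_sq h0 h1, geom_sum_sq h0 h1]
  · have h := qBinom_mul_qInt h0 h1 k d
    have e : (t ^ 2) ^ d * t ^ k * (t ^ (k + d))⁻¹ = t ^ d := by
      rw [pow_add, ← pow_mul]; field_simp; ring
    linear_combination (-1) ^ (k + 1) * qBinom t (k + d + 1) (k + 1) * qInt t (k + 1) * e +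
      (-1) ^ k * t ^ d * h
  · intro i hi
    rw [← pow_add]
    congr 1
    have := Finset.mem_range.mp hi
    omega
  · intro i hi
    congr 1
    have := Finset.mem_range.mp hi
    omega

/-- The identity behind the quantum Serre relations, in any commutative `ℂ`-algebra. -/
theorem serreSum_eq_zero {A : Type*} [CommRing A] [Algebra ℂ A] {t : ℂ} (h0 : t ≠ 0)
    (h1 : ‖t‖ < 1) (n : ℕ) (w : A) (z : Fin (n + 1) → A) :
    serreSum (algebraMap ℂ A (t ^ 2)) (algebraMap ℂ A (t ^ n)⁻¹)
      (fun k => algebraMap ℂ A ((-1) ^ k * qBinom t (n + 1) k)) w z = 0 := by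
  -- Root counting needs a domain and distinct nonzero variables, so the generic case is proved
  -- first and then specialized.
  let M := MvPolynomial (Option (Fin (n + 1))) ℂ
  have key : serreSum (MvPolynomial.C (t ^ 2) : M) (MvPolynomial.C (t ^ n)⁻¹)
      (fun k => MvPolynomial.C ((-1) ^ k * qBinom t (n + 1) k)) (MvPolynomial.X none)
      (fun s => MvPolynomial.X (some s)) = 0 := by
    refine serreSum_eq_zero_of_injective _ _ _ _ _ ?_ ?_ ?_ ?_
    · intro a b hab
      exact Option.some_injective _ (MvPolynomial.X_injective hab)
    · intro s
      exact MvPolynomial.X_ne_zero _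
    · intro k hk
      obtain ⟨d, rfl⟩ := Nat.exists_eq_add_of_le hk
      have := congrArg (MvPolynomial.C : ℂ →+* M) (sum_pow_mul_qBinom_const h0 h1 k d)
      simpa only [map_sum, map_mul, map_add, map_pow, apply_ite (MvPolynomial.C : ℂ →+* M),
        map_zero] using this
    · intro k hk
      obtain ⟨d, rfl⟩ := Nat.exists_eq_add_of_le hk
      have := congrArg (MvPolynomial.C : ℂ →+* M) (sum_pow_mul_qBinom_top h0 h1 k d)
      simpa only [map_sum, map_mul, map_add, map_pow, apply_ite (MvPolynomial.C : ℂ →+* M),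
        map_zero] using this
  have h := congrArg (MvPolynomial.aeval (R := ℂ) fun o : Option (Fin (n + 1)) => o.elim w z) key
  rw [map_zero, ← AlgHom.coe_toRingHom, map_serreSum] at h
  simpa using h

end QBinomial

/-! ### Series as a module over Laurent polynomials. -/

section Action

variable {G : Type*} [AddCommGroup G]

/-- Multiplication of series by monomials. -/
def shift : Multiplicative G →* Module.End ℂ (Series G) where
  toFun g :=
    { toFun := fun f p => f (p - g.toAdd)
      map_add' := fun _ _ => rfl
      map_smul' := fun _ _ => rfl }
  map_one' := by ext f p; simp
  map_mul' g h := by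
    ext f p
    simp only [toAdd_mul, LinearMap.coe_mk, AddHom.coe_mk, Module.End.mul_apply]
    congr 1
    abel

/-- Multiplication of series by Laurent polynomials. -/
def act : AddMonoidAlgebra ℂ G →ₐ[ℂ] Module.End ℂ (Series G) :=
  AddMonoidAlgebra.lift ℂ _ G shift

/-- The monomial with exponent `g`, as a Laurent polynomial. -/
def mono (g : G) : AddMonoidAlgebra ℂ G := AddMonoidAlgebra.single g 1

theorem mono_add (g h : G) : mono (g + h) = mono g * mono h := by
  simp [mono, AddMonoidAlgebra.single_mul_single]

theorem mono_zero : mono (0 : G) = 1 := rfl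

theorem act_mono_apply (g : G) (f : Series G) (p : G) : act (mono g) f p = f (p - g) := by
  simp [act, mono, shift]

theorem act_mul_apply (L M : AddMonoidAlgebra ℂ G) (f : Series G) :
    act (L * M) f = act L (act M f) := by
  rw [map_mul]; rfl

theorem act_one_apply (f : Series G) : act 1 f = f := by
  rw [map_one]; rfl

theorem act_algebraMap_apply (c : ℂ) (f : Series G) :
    act (algebraMap ℂ (AddMonoidAlgebra ℂ G) c) f = c • f := by
  rw [AlgHom.commutes]; rfl

theorem monomial_eq_act (g : G) : (monomial g : Series G) = act (mono g) (monomial 0) := by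
  classical
  ext p
  rw [act_mono_apply, monomial, monomial, Pi.single_apply, Pi.single_apply]
  simp [sub_eq_zero]

end Action

/-! ### Compatibility of infinite products of series with this action. -/

section Products

variable {G : Type*} [AddCommGroup G] {ι ι' : Type*} [Fintype ι] [Fintype ι']

theorem prod_update_apply {G ι : Type*} [Fintype ι] [DecidableEq ι] (f : ι → Series G)
    (i : ι) (v : Series G) (m : ι → G) :
    ∏ j, Function.update f i v j (m j) = v (m i) * ∏ j ∈ Finset.univ.erase i, f j (m j) := by
  rw [← Finset.mul_prod_erase _ _ (Finset.mem_univ i), Function.update_self]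
  congr 1
  refine Finset.prod_congr rfl fun j hj => ?_
  rw [Function.update_of_ne (Finset.ne_of_mem_erase hj)]

/-- A monomial merely translates the index set in coordinate `i`; linearity does the rest. -/
theorem prodSeries_update_act [DecidableEq ι] {f : ι → Series G} (hf : ProdExists f) (i : ι)
    (L : AddMonoidAlgebra ℂ G) :
    ProdExists (Function.update f i (act L (f i))) ∧
      prodSeries (Function.update f i (act L (f i))) = act L (prodSeries f) := by
  induction L using AddMonoidAlgebra.induction_on with
  | of g =>
    have e' : ∀ p : G, ∃ φ : {m : ι → G // ∑ j, m j = p} ≃ {m : ι → G // ∑ j, m j = p - g},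
        ∀ m j, (φ m).1 j = m.1 j - (Pi.single i g : ι → G) j := fun p =>
      ⟨(Equiv.subRight (Pi.single i g)).subtypeEquiv (by simp), fun m j => rfl⟩
    choose φ hφ using e'
    have h : ∀ p, (fun m : {m : ι → G // ∑ j, m j = p - g} => ∏ j, f j (m.1 j)) ∘ φ p =
        fun m => ∏ j, Function.update f i (act (mono g) (f i)) j (m.1 j) := by
      intro p
      ext m
      rw [prod_update_apply, Function.comp, ← Finset.mul_prod_erase _ _ (Finset.mem_univ i), hφ,
        Pi.single_eq_same, act_mono_apply]
      congr 1
      refine Finset.prod_congr rfl fun j hj => ?_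
      rw [hφ, Pi.single_eq_of_ne (Finset.ne_of_mem_erase hj), sub_zero]
    change ProdExists (Function.update f i (act (mono g) (f i))) ∧
      prodSeries (Function.update f i (act (mono g) (f i))) = act (mono g) (prodSeries f)
    constructor
    · intro p
      rw [← h, (φ p).summable_iff]
      exact hf _
    · ext p
      rw [act_mono_apply, prodSeries, prodSeries, ← (φ p).tsum_eq]
      exact congrArg tsum (h p).symm
  | add L M hL hM =>
    simp only [ProdExists, prodSeries, funext_iff, prod_update_apply, map_add,
      LinearMap.add_apply, Pi.add_apply, add_mul] at hL hM ⊢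
    exact ⟨fun p => (hL.1 p).add (hM.1 p), fun p => by
      rw [(hL.1 p).tsum_add (hM.1 p), hL.2, hM.2]⟩
  | smul c L hL =>
    simp only [ProdExists, prodSeries, funext_iff, prod_update_apply, map_smul,
      LinearMap.smul_apply, Pi.smul_apply, smul_eq_mul, mul_assoc] at hL ⊢
    exact ⟨fun p => (hL.1 p).mul_left c, fun p => by rw [tsum_mul_left, hL.2]⟩

/-- Multiplying the factors of an existing product by Laurent polynomials. -/
theorem prodSeries_act {f : ι → Series G} (hf : ProdExists f) (L : ι → AddMonoidAlgebra ℂ G) :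
    ProdExists (fun i => act (L i) (f i)) ∧
      prodSeries (fun i => act (L i) (f i)) = act (∏ i, L i) (prodSeries f) := by
  classical
  have key : ∀ s : Finset ι, ProdExists (fun i => if i ∈ s then act (L i) (f i) else f i) ∧
      prodSeries (fun i => if i ∈ s then act (L i) (f i) else f i) =
        act (∏ i ∈ s, L i) (prodSeries f) := by
    intro s
    induction s using Finset.induction_on with
    | empty => simpa [act_one_apply] using hf
    | insert a s ha ih =>
      have h := prodSeries_update_act ih.1 a (L a)
      have e : Function.update (fun i => if i ∈ s then act (L i) (f i) else f i) a
          (act (L a) (if a ∈ s then act (L a) (f a) else f a)) =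
          fun i => if i ∈ insert a s then act (L i) (f i) else f i := by
        ext i : 1
        by_cases h : i = a
        · subst h; simp [ha]
        · simp [h]
      rw [e, ih.2, ← act_mul_apply, ← Finset.prod_insert ha] at h
      exact h
  simpa using key Finset.univ

theorem prodExists_comp_equiv (e : ι ≃ ι') (f : ι' → Series G) :
    (ProdExists (fun i => f (e i)) ↔ ProdExists f) ∧
      prodSeries (fun i => f (e i)) = prodSeries f := by
  have e' : ∀ p : G, ∃ φ : {m : ι' → G // ∑ j, m j = p} ≃ {m : ι → G // ∑ j, m j = p},
      ∀ m i, (φ m).1 i = m.1 (e i) := fun p =>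
    ⟨(Equiv.arrowCongr e.symm (Equiv.refl G)).subtypeEquiv fun m => by
      simp [Equiv.arrowCongr, Equiv.sum_comp e m], fun m i => by simp [Equiv.arrowCongr]⟩
  choose φ hφ using e'
  have h : ∀ p, (fun m : {m : ι → G // ∑ j, m j = p} => ∏ i, f (e i) (m.1 i)) ∘ φ p =
      fun m => ∏ i, f i (m.1 i) := by
    intro p
    ext m
    simp only [Function.comp, hφ]
    exact Equiv.prod_comp e fun i => f i (m.1 i)
  constructor
  · refine forall_congr' fun p => ?_
    rw [← (φ p).summable_iff, h]
  · ext p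
    rw [prodSeries, prodSeries, ← (φ p).tsum_eq]
    exact congrArg tsum (h p)

theorem hasSum_prod_monomial_zero (p : G) :
    HasSum (fun m : {m : ι → G // ∑ i, m i = p} => ∏ i, (monomial 0 : Series G) (m.1 i))
      ((monomial 0 : Series G) p) := by
  classical
  have hz : ∀ m : ι → G, m ≠ 0 → ∏ i, (monomial 0 : Series G) (m i) = 0 := by
    intro m hm
    obtain ⟨i, hi⟩ := Function.ne_iff.mp hm
    exact Finset.prod_eq_zero (Finset.mem_univ i) (Pi.single_eq_of_ne hi _)
  by_cases hp : p = 0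
  · subst hp
    have h := hasSum_single (f := fun m : {m : ι → G // ∑ i, m i = 0} =>
      ∏ i, (monomial 0 : Series G) (m.1 i)) ⟨0, by simp⟩
      fun m hm => hz _ fun h => hm (Subtype.ext h)
    simpa [monomial] using h
  · rw [show (monomial 0 : Series G) p = 0 from Pi.single_eq_of_ne hp _]
    convert hasSum_zero with m
    refine hz _ fun h => hp ?_
    rw [← m.2, h]
    simp

theorem prodSeries_act_monomial_zero (L : ι → AddMonoidAlgebra ℂ G) :
    prodSeries (fun i => act (L i) (monomial 0)) = act (∏ i, L i) (monomial 0) := by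
  rw [(prodSeries_act (fun p => (hasSum_prod_monomial_zero p).summable) L).2]
  congr 1
  ext p
  exact (hasSum_prod_monomial_zero p).tsum_eq

theorem prodSeries_pair_act (L : AddMonoidAlgebra ℂ G) (g : Series G) :
    prodSeries ![act L (monomial 0), g] = act L g := by
  have h : ∀ p, HasSum (fun m : {m : Fin 2 → G // ∑ i, m i = p} =>
      ∏ i, (![monomial 0, g] : Fin 2 → Series G) i (m.1 i)) (g p) := by
    intro p
    have h := hasSum_single (f := fun m : {m : Fin 2 → G // ∑ i, m i = p} =>
      ∏ i, (![monomial 0, g] : Fin 2 → Series G) i (m.1 i)) ⟨![0, p], by simp⟩ ?_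
    · simpa [monomial] using h
    · rintro ⟨m, hm⟩ hne
      have h0 : m 0 ≠ 0 := by
        intro h0
        apply hne
        rw [Subtype.mk.injEq]
        ext i
        rw [Fin.sum_univ_two, h0, zero_add] at hm
        fin_cases i <;> simp [h0, hm]
      simp [monomial, h0]
  have h2 := (prodSeries_act (fun p => (h p).summable) ![L, 1]).2
  have e : (fun i => act (![L, 1] i) ((![monomial 0, g] : Fin 2 → Series G) i)) =
      ![act L (monomial 0), g] := by
    ext i : 1
    fin_cases i
    · rfl
    · exact act_one_apply g
  rw [e] at h2
  rw [h2, Fin.prod_univ_two]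
  simp only [Matrix.cons_val_zero, Matrix.cons_val_one, mul_one]
  congr 1
  ext p
  exact (h p).tsum_eq

end Products

/-! ### Substitution of monomials into one-variable series. -/

section Substitution

variable {G : Type*} [AddCommGroup G]

theorem subst_zsmul {μ : G} (hμ : Function.Injective fun n : ℤ => n • μ) (F : Series ℤ) (n : ℤ) :
    subst F μ (n • μ) = F n :=
  hμ.extend_apply F 0 n

theorem subst_of_not_exists {μ : G} (F : Series ℤ) {p : G} (h : ¬ ∃ n : ℤ, n • μ = p) :
    subst F μ p = 0 :=
  Function.extend_apply' _ _ _ h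

theorem subst_sub {μ : G} (hμ : Function.Injective fun n : ℤ => n • μ) (E F : Series ℤ) :
    subst (E - F) μ = subst E μ - subst F μ := by
  ext p
  by_cases h : ∃ n : ℤ, n • μ = p
  · obtain ⟨n, rfl⟩ := h
    simp [subst_zsmul hμ]
  · simp [subst_of_not_exists _ h]

theorem subst_smul {μ : G} (hμ : Function.Injective fun n : ℤ => n • μ) (c : ℂ) (F : Series ℤ) :
    subst (c • F) μ = c • subst F μ := by
  ext p
  by_cases h : ∃ n : ℤ, n • μ = p
  · obtain ⟨n, rfl⟩ := h
    simp [subst_zsmul hμ]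
  · simp [subst_of_not_exists _ h]

theorem subst_act_mono {μ : G} (hμ : Function.Injective fun n : ℤ => n • μ) (k : ℤ)
    (F : Series ℤ) : subst (act (mono k) F) μ = act (mono (k • μ)) (subst F μ) := by
  ext p
  rw [act_mono_apply]
  by_cases h : ∃ n : ℤ, n • μ = p
  · obtain ⟨n, rfl⟩ := h
    rw [subst_zsmul hμ, ← sub_smul, subst_zsmul hμ, act_mono_apply]
  · rw [subst_of_not_exists _ h, subst_of_not_exists]
    rintro ⟨n, hn⟩
    exact h ⟨n + k, by rw [add_smul, hn]; abel⟩

theorem neg_one_zsmul_injective : Function.Injective fun n : ℤ => n • (-1 : ℤ) := by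
  intro a b h
  simpa using h

theorem subst_subst_neg_one {μ : G} (hμ : Function.Injective fun n : ℤ => n • μ) (F : Series ℤ) :
    subst (subst F (-1 : ℤ)) μ = subst F (-μ) := by
  have hμ' : Function.Injective fun n : ℤ => n • (-μ) := by
    intro a b h
    simp only [smul_neg, neg_inj] at h
    exact hμ h
  ext p
  by_cases h : ∃ n : ℤ, n • μ = p
  · obtain ⟨n, rfl⟩ := h
    have h1 := subst_zsmul neg_one_zsmul_injective F (-n)
    have h2 := subst_zsmul hμ' F (-n)
    simp only [smul_neg, neg_smul, neg_neg, smul_eq_mul, mul_neg, mul_one] at h1 h2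
    rw [subst_zsmul hμ, h1, h2]
  · rw [subst_of_not_exists _ h, subst_of_not_exists]
    rintro ⟨n, hn⟩
    exact h ⟨-n, by rw [← hn]; simp⟩

/-- The functional equation of `IsSolution` after the substitution of a monomial. -/
theorem IsSolution.act_subst {l : ℕ} {a : Matrix (Fin l) (Fin l) ℤ} {d : Fin l → ℕ} {q : ℂ}
    {F : Fin l → Fin l → Series ℤ} (hF : IsSolution a d q F) {i j : Fin l} (h : a i j ≠ 0)
    {c : ℂ} (hc : q ^ ((d i : ℤ) * a i j) = c)
    {μ : G} (hμ : Function.Injective fun n : ℤ => n • μ) :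
    act (mono μ - algebraMap ℂ _ c) (subst (F j i) (-μ)) =
      act (algebraMap ℂ _ c * mono μ - 1) (subst (F i j) μ) := by
  have h1 := hF i j h
  rw [hc] at h1
  have e1 : monomial (1 : ℤ) - c • monomial (0 : ℤ) =
      act (mono (1 : ℤ) - algebraMap ℂ _ c) (monomial (0 : ℤ)) := by
    rw [monomial_eq_act (1 : ℤ)]
    simp only [map_sub, LinearMap.sub_apply, act_algebraMap_apply]
  have e2 : c • monomial (1 : ℤ) - monomial (0 : ℤ) =
      act (algebraMap ℂ _ c * mono (1 : ℤ) - 1) (monomial (0 : ℤ)) := by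
    rw [monomial_eq_act (1 : ℤ)]
    simp only [map_sub, LinearMap.sub_apply, act_algebraMap_apply, act_mul_apply, act_one_apply]
  rw [e1, e2, prodSeries_pair_act, prodSeries_pair_act] at h1
  have h2 := congrArg (fun E => subst E μ) h1
  simpa only [map_sub, LinearMap.sub_apply, act_algebraMap_apply, act_mul_apply, act_one_apply,
    subst_sub hμ, subst_smul hμ, subst_act_mono hμ, subst_subst_neg_one hμ, one_smul] using h2

end Substitution

/-! ### Products over pairs of indices and permutations. -/

section Pairs

variable {n : ℕ} {M : Type*} [CommMonoid M]

theorem prod_pairs_lt (g : Fin n → Fin n → M) :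
    ∏ x : {x : Fin n × Fin n // x.1 < x.2}, g x.1.1 x.1.2 =
      ∏ p, ∏ p', if p < p' then g p p' else 1 := by
  rw [← Fintype.prod_prod_type', ← Finset.prod_filter]
  exact (Finset.prod_subtype (p := fun x : Fin n × Fin n => x.1 < x.2) _ (by simp)
    (fun x => g x.1 x.2)).symm

theorem prod_pairs_ne (g : Fin n → Fin n → M) :
    ∏ x : {x : Fin n × Fin n // x.1 ≠ x.2}, g x.1.1 x.1.2 =
      ∏ x : {x : Fin n × Fin n // x.1 < x.2}, g x.1.1 x.1.2 * g x.1.2 x.1.1 := by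
  have h1 : ∏ x : {x : Fin n × Fin n // x.1 ≠ x.2}, g x.1.1 x.1.2 =
      ∏ p, ∏ p', if p ≠ p' then g p p' else 1 := by
    rw [← Fintype.prod_prod_type', ← Finset.prod_filter]
    exact (Finset.prod_subtype (p := fun x : Fin n × Fin n => x.1 ≠ x.2) _ (by simp)
      (fun x => g x.1 x.2)).symm
  rw [h1, Finset.prod_mul_distrib, prod_pairs_lt, prod_pairs_lt fun p p' => g p' p,
    Finset.prod_comm (f := fun p p' => if p < p' then g p' p else 1), ← Finset.prod_mul_distrib]
  refine Finset.prod_congr rfl fun p _ => ?_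
  rw [← Finset.prod_mul_distrib]
  refine Finset.prod_congr rfl fun p' _ => ?_
  rcases lt_trichotomy p p' with h | h | h
  · simp [h, h.ne, h.not_gt]
  · simp [h]
  · simp [h, h.ne', h.not_gt]

/-- The action of a permutation on unordered pairs, represented by increasing pairs. -/
def pairEquiv (π : Equiv.Perm (Fin n)) :
    {x : Fin n × Fin n // x.1 < x.2} ≃ {x : Fin n × Fin n // x.1 < x.2} where
  toFun x := ⟨(min (π x.1.1) (π x.1.2), max (π x.1.1) (π x.1.2)),
    min_lt_max.mpr fun h => x.2.ne (π.injective h)⟩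
  invFun x := ⟨(min (π.symm x.1.1) (π.symm x.1.2), max (π.symm x.1.1) (π.symm x.1.2)),
    min_lt_max.mpr fun h => x.2.ne (π.symm.injective h)⟩
  left_inv := by
    rintro ⟨⟨a, b⟩, h⟩
    rcases le_total (π a) (π b) with h' | h' <;> simp [h', (show a < b from h).le]
  right_inv := by
    rintro ⟨⟨a, b⟩, h⟩
    rcases le_total (π.symm a) (π.symm b) with h' | h' <;> simp [h', (show a < b from h).le]

theorem prod_pairs_comp_perm (π : Equiv.Perm (Fin n)) (h : Fin n → Fin n → M)
    (hsymm : ∀ a b, h a b = h b a) :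
    ∏ x : {x : Fin n × Fin n // x.1 < x.2}, h (π x.1.1) (π x.1.2) =
      ∏ x : {x : Fin n × Fin n // x.1 < x.2}, h x.1.1 x.1.2 := by
  rw [← (pairEquiv π).prod_comp fun x => h x.1.1 x.1.2]
  refine Finset.prod_congr rfl fun x _ => ?_
  rcases le_total (π x.1.1) (π x.1.2) with h' | h' <;> simp [pairEquiv, h', hsymm]

theorem prod_pairs_sign {R : Type*} [CommRing R] (π : Equiv.Perm (Fin n)) :
    (∏ x : {x : Fin n × Fin n // x.1 < x.2}, if π x.1.1 < π x.1.2 then (1 : R) else -1) =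
      ((Equiv.Perm.sign π : ℤ) : R) := by
  rw [prod_pairs_lt fun p p' => if π p < π p' then (1 : R) else -1, π.sign_eq_prod_prod_Ioi]
  push_cast
  refine Finset.prod_congr rfl fun p _ => ?_
  rw [← Finset.prod_filter, Finset.filter_lt_eq_Ioi]
  refine Finset.prod_congr rfl fun p' _ => ?_
  split_ifs <;> simp

end Pairs

section Exponents

variable {n : ℕ}

theorem zsmul_injective_of_apply_eq_one {σ : Type*} {μ : σ → ℤ} (o : σ) (h : μ o = 1) :
    Function.Injective fun k : ℤ => k • μ := by
  intro a b hab
  simpa [h] using congrFun hab o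

theorem zExp_sub_zExp_injective {a b : Fin n} (h : a ≠ b) :
    Function.Injective fun k : ℤ => k • (zExp a - zExp b) :=
  zsmul_injective_of_apply_eq_one (some a) (by simp [zExp, h])

theorem zExp_sub_wExp_injective (s : Fin n) :
    Function.Injective fun k : ℤ => k • (zExp s - wExp) :=
  zsmul_injective_of_apply_eq_one (some s) (by simp [zExp, wExp])

theorem wExp_sub_zExp_injective (s : Fin n) :
    Function.Injective fun k : ℤ => k • (wExp - zExp s) :=
  zsmul_injective_of_apply_eq_one none (by simp [zExp, wExp])

end Exponents

/-! ### The denominators as Laurent polynomials. -/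

section Denominators

variable {n : ℕ}

/-- `1 - c z_b / z_a`. -/
def pairDenom (c : ℂ) (a b : Fin n) : AddMonoidAlgebra ℂ (Exps n) :=
  1 - algebraMap ℂ _ c * mono (zExp b - zExp a)

/-- `sDenom` as a Laurent polynomial. -/
def sDenomPoly (n : ℕ) (c : ℂ) : AddMonoidAlgebra ℂ (Exps n) :=
  ∏ x : {x : Fin n × Fin n // x.1 ≠ x.2}, pairDenom c x.1.1 x.1.2

/-- `rDenom'` as a Laurent polynomial. -/
def rDenomPoly (n : ℕ) (c : ℂ) : AddMonoidAlgebra ℂ (Exps n) :=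
  ∏ s : Fin n, (mono (zExp s - wExp) - algebraMap ℂ _ c)

theorem sDenom_eq_act (n : ℕ) (c : ℂ) : sDenom n c = act (sDenomPoly n c) (monomial 0) := by
  rw [sDenomPoly, ← prodSeries_act_monomial_zero, sDenom]
  congr 1
  ext x : 1
  rw [monomial_eq_act (zExp x.1.2 - zExp x.1.1), pairDenom]
  simp only [map_sub, LinearMap.sub_apply, act_algebraMap_apply, act_mul_apply, act_one_apply]

theorem rDenom'_eq_act (n : ℕ) (c : ℂ) : rDenom' n c = act (rDenomPoly n c) (monomial 0) := by
  rw [rDenomPoly, ← prodSeries_act_monomial_zero, rDenom']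
  congr 1
  ext s : 1
  rw [monomial_eq_act (zExp s - wExp)]
  simp only [map_sub, LinearMap.sub_apply, act_algebraMap_apply]

theorem sDenomPoly_eq_prod_perm (c : ℂ) (π : Equiv.Perm (Fin n)) :
    sDenomPoly n c = ∏ x : {x : Fin n × Fin n // x.1 < x.2},
      pairDenom c (π x.1.1) (π x.1.2) * pairDenom c (π x.1.2) (π x.1.1) := by
  rw [prod_pairs_comp_perm π (fun a b => pairDenom c a b * pairDenom c b a)
    fun a b => mul_comm _ _]
  exact prod_pairs_ne _

theorem rDenomPoly_eq_prod_perm (c : ℂ) (π : Equiv.Perm (Fin n)) :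
    rDenomPoly n c = ∏ s : Fin n, (mono (zExp (π s) - wExp) - algebraMap ℂ _ c) :=
  (Equiv.prod_comp π fun s => mono (zExp s - wExp) - algebraMap ℂ _ c).symm

end Denominators

/-! ### Reduction of all terms to a single series. -/

section Terms

variable {n : ℕ} {Fii Fij Fji : Series ℤ} {c c' : ℂ}

theorem mono_mul_mono_neg {G : Type*} [AddCommGroup G] (g : G) : mono g * mono (-g) = 1 := by
  rw [← mono_add, add_neg_cancel, mono_zero]

/-- The right side orients the pair increasingly, so its series no longer depends on the order of
`a` and `b`. For `a > b` the functional equation performs the flip and yields the sign of an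
inversion. -/
theorem act_pairDenom_subst
    (hii : ∀ a b : Fin n, a ≠ b →
      act (mono (zExp a - zExp b) - algebraMap ℂ _ c) (subst Fii (-(zExp a - zExp b))) =
        act (algebraMap ℂ _ c * mono (zExp a - zExp b) - 1) (subst Fii (zExp a - zExp b)))
    {a b : Fin n} (hab : a ≠ b) :
    act (pairDenom c a b * pairDenom c b a) (subst Fii (zExp b - zExp a)) =
      act (pairDenom c (min a b) (max a b) * mono (-zExp (max a b)) *
        (if a < b then 1 else -1) * (mono (zExp b) - algebraMap ℂ _ c * mono (zExp a)))
        (subst Fii (zExp (max a b) - zExp (min a b))) := by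
  rcases lt_or_gt_of_ne hab with h | h
  · rw [min_eq_left h.le, max_eq_right h.le, if_pos h]
    congr 2
    have h1 := mono_mul_mono_neg (zExp b)
    simp only [pairDenom, sub_eq_add_neg (zExp _), mono_add]
    linear_combination (-(1 - algebraMap ℂ _ c * (mono (zExp b) * mono (-zExp a)))) * h1
  · rw [min_eq_right h.le, max_eq_left h.le, if_neg h.not_gt]
    have h1 := mono_mul_mono_neg (zExp b)
    have e1 : pairDenom c a b * pairDenom c b a = pairDenom c b a * mono (-(zExp a - zExp b)) *
        (mono (zExp a - zExp b) - algebraMap ℂ _ c) := by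
      have h3 := mono_mul_mono_neg (zExp a - zExp b)
      rw [neg_sub] at h3 ⊢
      rw [pairDenom]
      linear_combination (-pairDenom c b a) * h3
    have e2 : pairDenom c b a * mono (-(zExp a - zExp b)) *
        (algebraMap ℂ _ c * mono (zExp a - zExp b) - 1) = pairDenom c b a * mono (-zExp a) *
        (-1) * (mono (zExp b) - algebraMap ℂ _ c * mono (zExp a)) := by
      rw [neg_sub]
      simp only [sub_eq_add_neg (zExp _), mono_add]
      linear_combination (pairDenom c b a * algebraMap ℂ _ c * mono (zExp a) * mono (-zExp a)) * h1
    rw [e1, act_mul_apply, ← neg_sub (zExp a) (zExp b), hii a b hab, ← act_mul_apply, e2]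

theorem act_wDenom_subst
    (hij : ∀ s : Fin n,
      act (mono (zExp s - wExp) - algebraMap ℂ _ c') (subst Fji (-(zExp s - wExp))) =
        act (algebraMap ℂ _ c' * mono (zExp s - wExp) - 1) (subst Fij (zExp s - wExp)))
    (s : Fin n) (P : Prop) [Decidable P] :
    act (mono (zExp s - wExp) - algebraMap ℂ _ c')
        (if P then subst Fji (wExp - zExp s) else subst Fij (zExp s - wExp)) =
      act (mono (-wExp) * if P then algebraMap ℂ _ c' * mono (zExp s) - mono wExp
        else mono (zExp s) - algebraMap ℂ _ c' * mono wExp) (subst Fij (zExp s - wExp)) := by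
  have wExp_mul_inv := mono_mul_mono_neg (wExp : Exps n)
  split_ifs
  · rw [← neg_sub (zExp s) wExp, hij s]
    congr 2
    simp only [sub_eq_add_neg (zExp _), mono_add]
    linear_combination wExp_mul_inv
  · congr 2
    simp only [sub_eq_add_neg (zExp _), mono_add]
    linear_combination (algebraMap ℂ _ c') * wExp_mul_inv

/-- The part of the numerators that is common to all the terms of `serreSeries`. -/
def commonNumerator (n : ℕ) (c : ℂ) : AddMonoidAlgebra ℂ (Exps n) :=
  (∏ x : {x : Fin n × Fin n // x.1 < x.2}, pairDenom c x.1.1 x.1.2 * mono (-zExp x.1.2)) *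
    ∏ _s : Fin n, mono (-wExp)

/-- After multiplication by the denominators each term of `serreSeries` is a multiple of a single
series. -/
theorem act_denom_prodSeries_termFactors
    (hii : ∀ a b : Fin n, a ≠ b →
      act (mono (zExp a - zExp b) - algebraMap ℂ _ c) (subst Fii (-(zExp a - zExp b))) =
        act (algebraMap ℂ _ c * mono (zExp a - zExp b) - 1) (subst Fii (zExp a - zExp b)))
    (hij : ∀ s : Fin n,
      act (mono (zExp s - wExp) - algebraMap ℂ _ c') (subst Fji (-(zExp s - wExp))) =
        act (algebraMap ℂ _ c' * mono (zExp s - wExp) - 1) (subst Fij (zExp s - wExp)))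
    {π : Equiv.Perm (Fin n)} {k : ℕ} (hπ : ProdExists (termFactors Fii Fij Fji π k))
    (h1 : ProdExists (termFactors Fii Fij Fji (1 : Equiv.Perm (Fin n)) 0)) :
    act (sDenomPoly n c * rDenomPoly n c') (prodSeries (termFactors Fii Fij Fji π k)) =
      act (commonNumerator n c * (((Equiv.Perm.sign π : ℤ) : AddMonoidAlgebra ℂ (Exps n)) *
        ((∏ p, ∏ p', if p < p' then mono (zExp (π p')) - algebraMap ℂ _ c * mono (zExp (π p))
          else 1) *
        ∏ s : Fin n, if (s : ℕ) < k then algebraMap ℂ _ c' * mono (zExp (π s)) - mono wExp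
          else mono (zExp (π s)) - algebraMap ℂ _ c' * mono wExp)))
        (prodSeries (termFactors Fii Fij Fji (1 : Equiv.Perm (Fin n)) 0)) := by
  -- `e` matches each factor of the term `(π, k)` with the factor of the term `(1, 0)` in the same
  -- variables; `L` collects the denominators, `K` the resulting numerators.
  let e := Equiv.sumCongr (pairEquiv π) π
  let L : {x : Fin n × Fin n // x.1 < x.2} ⊕ Fin n → AddMonoidAlgebra ℂ (Exps n) :=
    Sum.elim (fun x => pairDenom c (π x.1.1) (π x.1.2) * pairDenom c (π x.1.2) (π x.1.1))
      (fun s => mono (zExp (π s) - wExp) - algebraMap ℂ _ c')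
  let K : {x : Fin n × Fin n // x.1 < x.2} ⊕ Fin n → AddMonoidAlgebra ℂ (Exps n) :=
    Sum.elim (fun x => pairDenom c (pairEquiv π x).1.1 (pairEquiv π x).1.2 *
        mono (-zExp (pairEquiv π x).1.2) * (if π x.1.1 < π x.1.2 then 1 else -1) *
        (mono (zExp (π x.1.2)) - algebraMap ℂ _ c * mono (zExp (π x.1.1))))
      (fun s => mono (-wExp) * if (s : ℕ) < k then algebraMap ℂ _ c' * mono (zExp (π s)) - mono wExp
          else mono (zExp (π s)) - algebraMap ℂ _ c' * mono wExp)
  have hL : sDenomPoly n c * rDenomPoly n c' = ∏ i, L i := by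
    rw [Fintype.prod_sum_type, sDenomPoly_eq_prod_perm c π, rDenomPoly_eq_prod_perm c' π]
    rfl
  have hK : ∏ i, K i = commonNumerator n c *
      (((Equiv.Perm.sign π : ℤ) : AddMonoidAlgebra ℂ (Exps n)) *
        ((∏ p, ∏ p', if p < p' then mono (zExp (π p')) - algebraMap ℂ _ c * mono (zExp (π p))
          else 1) *
        ∏ s : Fin n, if (s : ℕ) < k then algebraMap ℂ _ c' * mono (zExp (π s)) - mono wExp
          else mono (zExp (π s)) - algebraMap ℂ _ c' * mono wExp)) := by
    rw [Fintype.prod_sum_type]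
    simp only [K, Sum.elim_inl, Sum.elim_inr]
    rw [Finset.prod_mul_distrib, Finset.prod_mul_distrib, Finset.prod_mul_distrib (s := Finset.univ)
      (f := fun _ : Fin n => mono (-wExp)), prod_pairs_sign, commonNumerator,
      (pairEquiv π).prod_comp (fun x => pairDenom c x.1.1 x.1.2 * mono (-zExp x.1.2)),
      prod_pairs_lt fun p p' => mono (zExp (π p')) - algebraMap ℂ _ c * mono (zExp (π p))]
    ring
  have hfam : (fun i => act (L i) (termFactors Fii Fij Fji π k i)) =
      fun i => act (K i) (termFactors Fii Fij Fji (1 : Equiv.Perm (Fin n)) 0 (e i)) := by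
    ext i : 1
    rcases i with x | s
    · exact act_pairDenom_subst hii fun h => x.2.ne (π.injective h)
    · exact act_wDenom_subst hij (π s) _
  obtain ⟨hiff, heq⟩ := prodExists_comp_equiv e (termFactors Fii Fij Fji (1 : Equiv.Perm (Fin n)) 0)
  rw [hL, ← (prodSeries_act hπ L).2, hfam, (prodSeries_act (hiff.mpr h1) K).2, heq, hK]

/-- The denominators annihilate `serreSeries`. -/
theorem act_denom_serreSeries {m : ℕ} {t : ℂ} (ht0 : t ≠ 0) (ht1 : ‖t‖ < 1) (hn : n = m + 1)
    (hc : c = t ^ 2) (hc' : c' = (t ^ m)⁻¹)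
    (hii : ∀ a b : Fin n, a ≠ b →
      act (mono (zExp a - zExp b) - algebraMap ℂ _ c) (subst Fii (-(zExp a - zExp b))) =
        act (algebraMap ℂ _ c * mono (zExp a - zExp b) - 1) (subst Fii (zExp a - zExp b)))
    (hij : ∀ s : Fin n,
      act (mono (zExp s - wExp) - algebraMap ℂ _ c') (subst Fji (-(zExp s - wExp))) =
        act (algebraMap ℂ _ c' * mono (zExp s - wExp) - 1) (subst Fij (zExp s - wExp)))
    (hex : ∀ (π : Equiv.Perm (Fin n)), ∀ k ≤ n, ProdExists (termFactors Fii Fij Fji π k)) :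
    act (sDenomPoly n c * rDenomPoly n c') (serreSeries n t Fii Fij Fji) = 0 := by
  subst hn
  set B := prodSeries (termFactors Fii Fij Fji (1 : Equiv.Perm (Fin (m + 1))) 0) with hB
  have hsum := serreSum_eq_zero ht0 ht1 m (mono wExp : AddMonoidAlgebra ℂ (Exps (m + 1)))
    (fun s => mono (zExp s))
  rw [← hc, ← hc'] at hsum
  have hB0 : act (commonNumerator (m + 1) c * serreSum (algebraMap ℂ _ c) (algebraMap ℂ _ c')
      (fun k => algebraMap ℂ _ ((-1) ^ k * qBinom t (m + 1) k))
      (mono wExp : AddMonoidAlgebra ℂ (Exps (m + 1))) (fun s => mono (zExp s))) B = 0 := by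
    rw [hsum, mul_zero, map_zero, LinearMap.zero_apply]
  rw [← hB0, serreSeries, map_sum, serreSum, Finset.mul_sum, map_sum, LinearMap.sum_apply]
  refine Finset.sum_congr rfl fun π _ => ?_
  rw [map_sum, serreSummand, Finset.mul_sum, Finset.mul_sum, Finset.mul_sum, map_sum,
    LinearMap.sum_apply]
  refine Finset.sum_congr rfl fun k hk => ?_
  rw [map_smul, act_denom_prodSeries_termFactors hii hij
    (hex π k (Nat.lt_succ_iff.mp (Finset.mem_range.mp hk))) (hex 1 0 (Nat.zero_le _)), ← hB,
    ← act_algebraMap_apply, ← act_mul_apply]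
  refine congrArg (fun L => act L B) ?_
  ring

end Terms

/-! ### Associativity extracted from the fivefold product. -/

section Cancellation

variable {G : Type*} [AddCommGroup G]

theorem hasSum_act (L : AddMonoidAlgebra ℂ G) (f : Series G) (p : G) :
    HasSum (fun g => act L (monomial 0) g * f (p - g)) (act L f p) := by
  induction L using AddMonoidAlgebra.induction_on with
  | of g =>
    change HasSum (fun g' => act (mono g) (monomial 0) g' * f (p - g')) (act (mono g) f p)
    rw [← monomial_eq_act, act_mono_apply]
    have h := hasSum_single (f := fun g' => (monomial g : Series G) g' * f (p - g')) g
      fun g' hg' => by simp [monomial, hg']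
    simpa [monomial] using h
  | add L M hL hM =>
    simpa only [map_add, LinearMap.add_apply, Pi.add_apply, add_mul] using hL.add hM
  | smul c L hL =>
    simpa only [map_smul, LinearMap.smul_apply, Pi.smul_apply, smul_eq_mul, mul_assoc]
      using hL.mul_left c

/-- If `s` and `r` are inverse to the Laurent polynomials `L` and `M`, and the product of the five
series `s`, `r`, `L`, `M`, `P` exists, then `P` can be recovered from `L * M * P`. -/
theorem eq_zero_of_prodExists {s r P : Series G} {L M : AddMonoidAlgebra ℂ G}
    (hs : act L s = monomial 0) (hr : act M r = monomial 0) (h0 : act (L * M) P = 0)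
    (hex : ProdExists ![s, r, act L (monomial 0), act M (monomial 0), P]) : P = 0 := by
  ext p
  let H : ((G × G) × G) × G → ℂ := fun x => s x.1.1.1 * r x.1.1.2 *
    (act L (monomial 0) x.1.2 * (act M (monomial 0) x.2 * P (p - x.1.1.1 - x.1.1.2 - x.1.2 - x.2)))
  have hH : Summable H := by
    let j : ((G × G) × G) × G → {m : Fin 5 → G // ∑ i, m i = p} := fun x =>
      ⟨![x.1.1.1, x.1.1.2, x.1.2, x.2, p - x.1.1.1 - x.1.1.2 - x.1.2 - x.2], by
        simp [Fin.sum_univ_succ]⟩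
    have hj : Function.Injective j := by
      rintro ⟨⟨⟨a, b⟩, c⟩, d⟩ ⟨⟨⟨a', b'⟩, c'⟩, d'⟩ h
      have h' := congrArg Subtype.val h
      have e0 := congrFun h' 0
      have e1 := congrFun h' 1
      have e2 := congrFun h' 2
      have e3 := congrFun h' 3
      simp only [j, Matrix.cons_val] at e0 e1 e2 e3
      simp [e0, e1, e2, e3]
    refine ((hex p).comp_injective hj).congr fun x => ?_
    simp only [Function.comp, j, H, Fin.prod_univ_succ, Fin.prod_univ_zero]
    simp
    ring
  -- First bracketing: summing over the exponents of `M`, then of `L`, produces coefficients of `L *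
  -- M * P`.
  have hH0 : HasSum H 0 := by
    have h1 := hH.hasSum.prod_fiberwise fun x =>
      ((hasSum_act M P (p - x.1.1 - x.1.2 - x.2)).mul_left (act L (monomial 0) x.2)).mul_left
        (s x.1.1 * r x.1.2)
    have h2 := h1.prod_fiberwise fun x =>
      (hasSum_act L (act M P) (p - x.1 - x.2)).mul_left (s x.1 * r x.2)
    simp only [← act_mul_apply, h0, Pi.zero_apply, mul_zero] at h2
    have h3 := hH.hasSum
    rwa [h2.unique hasSum_zero] at h3
  -- Second bracketing: the new coordinates are the total exponents of `s · L` and of `r · M`, so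
  -- the exponent of `P` stays fixed in the inner sums.
  let E : ((G × G) × G) × G ≃ ((G × G) × G) × G :=
    { toFun := fun x => (((x.1.1.1 - x.1.2, x.1.1.2 - x.2), x.1.2), x.2)
      invFun := fun x => (((x.1.1.1 + x.1.2, x.1.1.2 + x.2), x.1.2), x.2)
      left_inv := fun x => by simp
      right_inv := fun x => by simp }
  have hE : HasSum (fun x : ((G × G) × G) × G =>
      P (p - x.1.1.1 - x.1.1.2) * (act L (monomial 0) x.1.2 * s (x.1.1.1 - x.1.2)) *
        (act M (monomial 0) x.2 * r (x.1.1.2 - x.2))) 0 := by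
    convert E.hasSum_iff.mpr hH0 using 2 with x
    simp only [Function.comp, H, E, Equiv.coe_fn_mk]
    rw [show p - (x.1.1.1 - x.1.2) - (x.1.1.2 - x.2) - x.1.2 - x.2 = p - x.1.1.1 - x.1.1.2 by abel]
    ring
  have h1 := hE.prod_fiberwise fun x => (hasSum_act M r x.1.2).mul_left
    (P (p - x.1.1 - x.1.2) * (act L (monomial 0) x.2 * s (x.1.1 - x.2)))
  have h2 := h1.prod_fiberwise fun x =>
    ((hasSum_act L s x.1).mul_left (P (p - x.1 - x.2))).mul_right (act M r x.2)
  have h3 := hasSum_single (f := fun x : G × G => P (p - x.1 - x.2) * act L s x.1 * act M r x.2)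
    (0, 0) fun x hx => by
      rw [hs, hr]
      by_cases hx1 : x.1 = 0
      · have hx2 : x.2 ≠ 0 := fun hx2 => hx (Prod.ext hx1 hx2)
        simp [monomial, hx2]
      · simp [monomial, hx1]
  have h4 := h3.unique h2
  simpa [hs, hr, monomial] using h4

end Cancellation

/-! ### The series $s_{ij}$ and $r'_{ij}$ invert the denominators. -/

section Inverses

theorem subst_monomial_zero {G : Type*} [AddCommGroup G] {μ : G}
    (hμ : Function.Injective fun n : ℤ => n • μ) :
    subst (monomial (0 : ℤ)) μ = (monomial 0 : Series G) := by
  ext p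
  by_cases h : ∃ n : ℤ, n • μ = p
  · obtain ⟨n, rfl⟩ := h
    rw [subst_zsmul hμ]
    by_cases hn : n = 0
    · simp [hn, monomial]
    · have h' : n • μ ≠ 0 := fun h0 => hn (hμ (by simpa using h0))
      simp [monomial, hn, h']
  · have h' : p ≠ 0 := fun hp => h ⟨0, by simp [hp]⟩
    rw [subst_of_not_exists _ h]
    simp [monomial, h']

theorem geom_sub_act {c : ℂ} (hc : c ≠ 0) :
    geom c - c • act (mono (1 : ℤ)) (geom c) = monomial 0 := by
  ext n
  simp only [Pi.sub_apply, Pi.smul_apply, smul_eq_mul, act_mono_apply, geom]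
  rcases lt_trichotomy n 0 with h | h | h
  · simp [monomial, h.ne, show ¬ 0 ≤ n by omega, show ¬ 1 ≤ n by omega]
  · simp [monomial, h]
  · simp only [h.le, if_true, show 0 ≤ n - 1 by omega]
    rw [show (monomial 0 : Series ℤ) n = 0 by simp [monomial, h.ne'], zpow_sub_one₀ hc]
    field_simp
    ring

theorem act_geomShift_sub {c : ℂ} (hc : c ≠ 0) :
    act (mono (-1 : ℤ)) (geomShift c) - c • geomShift c = monomial 0 := by
  ext n
  simp only [Pi.sub_apply, Pi.smul_apply, smul_eq_mul, act_mono_apply, geomShift]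
  rcases lt_trichotomy n 0 with h | h | h
  · simp [monomial, h.ne, show ¬ 0 ≤ n by omega, show ¬ 1 ≤ n by omega]
  · simp [monomial, h]
  · simp only [show 1 ≤ n by omega, if_true, show 1 ≤ n - -1 by omega]
    rw [show (monomial 0 : Series ℤ) n = 0 by simp [monomial, h.ne'], show n - -1 - 1 = n by ring,
      zpow_sub_one₀ hc]
    field_simp
    ring

/-- A finite family of absolutely summable series has a product. -/
theorem prodExists_of_summable_norm {G ι : Type*} [AddCommGroup G] [Fintype ι] {f : ι → Series G}
    (hf : ∀ i, Summable fun g => ‖f i g‖) : ProdExists f := by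
  classical
  intro p
  have h : Summable fun m : ι → G => ‖∏ i, f i (m i)‖ := by
    refine summable_of_sum_le (c := ∏ i, ∑' g, ‖f i g‖) (fun m => norm_nonneg _) fun u => ?_
    calc ∑ m ∈ u, ‖∏ i, f i (m i)‖
        ≤ ∑ m ∈ Fintype.piFinset fun i => u.image fun m => m i, ‖∏ i, f i (m i)‖ := by
          refine Finset.sum_le_sum_of_subset_of_nonneg (fun m hm => ?_) fun _ _ _ => norm_nonneg _
          exact Fintype.mem_piFinset.mpr fun i => Finset.mem_image_of_mem _ hm
      _ = ∏ i, ∑ g ∈ u.image fun m => m i, ‖f i g‖ := by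
          rw [Finset.prod_univ_sum]
          simp only [norm_prod]
      _ ≤ ∏ i, ∑' g, ‖f i g‖ :=
          Finset.prod_le_prod (fun i _ => Finset.sum_nonneg fun _ _ => norm_nonneg _)
            fun i _ => (hf i).sum_le_tsum _ fun _ _ => norm_nonneg _
  exact h.of_norm.comp_injective Subtype.val_injective

theorem summable_norm_geom {c : ℂ} (hc : ‖c‖ < 1) : Summable fun n : ℤ => ‖geom c n‖ := by
  rw [← (Nat.cast_injective (R := ℤ)).summable_iff]
  · simpa [geom, Function.comp_def] using summable_geometric_of_lt_one (norm_nonneg c) hc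
  · intro n hn
    have : ¬ 0 ≤ n := fun h => hn ⟨n.toNat, Int.toNat_of_nonneg h⟩
    simp [geom, this]

theorem summable_norm_subst {G : Type*} [AddCommGroup G] {μ : G}
    (hμ : Function.Injective fun n : ℤ => n • μ) {F : Series ℤ} (hF : Summable fun n => ‖F n‖) :
    Summable fun g => ‖subst F μ g‖ := by
  rw [← hμ.summable_iff]
  · simpa only [Function.comp_def, subst_zsmul hμ] using hF
  · intro g hg
    rw [subst_of_not_exists F hg, norm_zero]

/-- Both $z_p/z_{p'}$ and its inverse occur, so coefficients are infinite sums; `‖c‖ < 1` makes them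
converge absolutely. -/
theorem act_sDenomPoly_sSeries (n : ℕ) {c : ℂ} (hc0 : c ≠ 0) (hc1 : ‖c‖ < 1) :
    act (sDenomPoly n c) (sSeries n c) = monomial 0 := by
  have hμ : ∀ x : {x : Fin n × Fin n // x.1 ≠ x.2},
      Function.Injective fun k : ℤ => k • (zExp x.1.2 - zExp x.1.1) :=
    fun x => zExp_sub_zExp_injective x.2.symm
  have hex : ProdExists fun x : {x : Fin n × Fin n // x.1 ≠ x.2} =>
      subst (geom c) (zExp x.1.2 - zExp x.1.1) :=
    prodExists_of_summable_norm fun x => summable_norm_subst (hμ x) (summable_norm_geom hc1)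
  rw [sDenomPoly, sSeries, ← (prodSeries_act hex _).2]
  have h : ∀ x : {x : Fin n × Fin n // x.1 ≠ x.2}, act (pairDenom c x.1.1 x.1.2)
      (subst (geom c) (zExp x.1.2 - zExp x.1.1)) = act 1 (monomial 0) := by
    intro x
    rw [act_one_apply, ← subst_monomial_zero (hμ x), ← geom_sub_act hc0, subst_sub (hμ x),
      subst_smul (hμ x), subst_act_mono (hμ x), pairDenom, one_smul, map_sub,
      LinearMap.sub_apply, act_one_apply, act_mul_apply, act_algebraMap_apply]
  simp only [h]
  rw [prodSeries_act_monomial_zero, Finset.prod_const_one, act_one_apply]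

/-- No bound on `F` is needed (in the application $|q^{b_{ij}}|>1$): `z_s` occurs only in factor
`s`, so the total exponent determines every factor's exponent and at most one product is nonzero. -/
theorem prodExists_subst_wExp_sub_zExp (n : ℕ) (F : Series ℤ) :
    ProdExists fun s : Fin n => subst F (wExp - zExp s) := by
  intro p
  refine summable_of_hasFiniteSupport (Set.Subsingleton.finite ?_)
  have key : ∀ m : {m : Fin n → Exps n // ∑ i, m i = p},
      ∏ s, subst F (wExp - zExp s) (m.1 s) ≠ 0 →
      ∀ s, m.1 s = (-p (some s)) • (wExp - zExp s) := by
    intro m hm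
    have h1 : ∀ s, ∃ k : ℤ, k • (wExp - zExp s) = m.1 s := by
      intro s
      by_contra hs
      exact hm (Finset.prod_eq_zero (Finset.mem_univ s) (subst_of_not_exists _ hs))
    choose k hk using h1
    intro s
    have h2 := congrFun m.2 (some s)
    rw [Finset.sum_apply, Finset.sum_eq_single s] at h2
    · rw [← hk s] at h2 ⊢
      rw [← h2]
      simp [zExp, wExp]
    · intro s' _ hs'
      rw [← hk s']
      simp [zExp, wExp, hs'.symm]
    · simp
  intro m hm m' hm'
  exact Subtype.ext (funext fun s => (key m hm s).trans (key m' hm' s).symm)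

theorem act_rDenomPoly_rSeries' (n : ℕ) {c : ℂ} (hc0 : c ≠ 0) :
    act (rDenomPoly n c) (rSeries' n c) = monomial 0 := by
  rw [rDenomPoly, rSeries', ← (prodSeries_act (prodExists_subst_wExp_sub_zExp n _) _).2]
  have h : ∀ s : Fin n, act (mono (zExp s - wExp) - algebraMap ℂ _ c)
      (subst (geomShift c) (wExp - zExp s)) = act 1 (monomial 0) := by
    intro s
    have hμ := wExp_sub_zExp_injective s
    rw [act_one_apply, ← subst_monomial_zero hμ, ← act_geomShift_sub hc0, subst_sub hμ,
      subst_smul hμ, subst_act_mono hμ, neg_one_smul, neg_sub, map_sub, LinearMap.sub_apply,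
      act_algebraMap_apply]
  simp only [h]
  rw [prodSeries_act_monomial_zero, Finset.prod_const_one, act_one_apply]

end Inverses

end QuantumSerre

end

theorem theorem4 {l : ℕ} (a : Matrix (Fin l) (Fin l) ℤ) (d : Fin l → ℕ)
    (had : QuantumSerre.IsSymmetrizedGCM a d) (q : ℂ) (hq0 : q ≠ 0) (hq1 : ‖q‖ < 1)
    (F : Fin l → Fin l → QuantumSerre.Series ℤ) (hF : QuantumSerre.IsSolution a d q F)
    (i j : Fin l) (hij : i ≠ j) (haij : a i j ≠ 0)
    (hwd : QuantumSerre.ConstraintWellDefined (1 - a i j).toNat (q ^ d i)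
      (q ^ ((d i : ℤ) * a i i)) (q ^ ((d i : ℤ) * a i j)) (F i i) (F i j) (F j i)) :
    QuantumSerre.serreSeries (1 - a i j).toNat (q ^ d i) (F i i) (F i j) (F j i) = 0 := by
  have hneg : a i j ≤ 0 := had.nonpos i j hij
  have hdi : d i ≠ 0 := (had.pos i).ne'
  have ht0 : q ^ d i ≠ 0 := pow_ne_zero _ hq0
  have ht1 : ‖q ^ d i‖ < 1 := by
    rw [norm_pow]
    exact pow_lt_one₀ (norm_nonneg q) hq1 hdi
  -- With $t=q_i$ and $m+1$ variables $z$, the constants $q^{b_{ii}}=t^2$ and $q^{b_{ij}}=t^{-m}$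
  -- are exactly those of `serreSum_eq_zero`.
  obtain ⟨m, hm⟩ : ∃ m : ℕ, a i j = -(m : ℤ) := ⟨(-a i j).toNat, by omega⟩
  have hn : (1 - a i j).toNat = m + 1 := by omega
  have hcii : q ^ ((d i : ℤ) * a i i) = (q ^ d i) ^ 2 := by
    rw [had.diag i, zpow_mul, zpow_natCast]
    norm_cast
  have hcij : q ^ ((d i : ℤ) * a i j) = ((q ^ d i) ^ m)⁻¹ := by
    rw [hm, zpow_mul, zpow_natCast, zpow_neg, zpow_natCast]
  obtain ⟨hex, hprod⟩ := hwd
  rw [QuantumSerre.sDenom_eq_act, QuantumSerre.rDenom'_eq_act] at hprod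
  refine QuantumSerre.eq_zero_of_prodExists
    (QuantumSerre.act_sDenomPoly_sSeries _ (zpow_ne_zero _ hq0) ?_)
    (QuantumSerre.act_rDenomPoly_rSeries' _ (zpow_ne_zero _ hq0)) ?_ hprod
  · rw [hcii, norm_pow]
    exact pow_lt_one₀ (norm_nonneg _) ht1 two_ne_zero
  · refine QuantumSerre.act_denom_serreSeries ht0 ht1 hn hcii hcij ?_ ?_ hex
    · intro p p' hp
      exact hF.act_subst (by rw [had.diag i]; exact two_ne_zero) rfl
        (QuantumSerre.zExp_sub_zExp_injective hp)
    · intro s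
      exact hF.act_subst haij rfl (QuantumSerre.zExp_sub_wExp_injective s)
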